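/- **Definitions.** An *order unit space* is a partially ordered real vector space $A$ with an element $1_A$ (the order unit) such that every $a\in A$ satisfies $-\lambda 1_A\le a\le\lambda 1_A$ for some $\lambda>0$, and such that $a\le 0$ whenever $a\le\lambda 1_A$ for all $\lambda>0$. It carries the norm $\|a\|_A=\inf\{\lambda>0:-\lambda 1_A\le a\le\lambda 1_A\}$. Its state space $\mathscr S(A)$ is the set of positive linear functionals $\varphi$ on $A$ with $\varphi(1_A)=1$. The direct sum $A\oplus B$ has the componentwise order and the order unit $(1_A,1_B)$. A *quantum metric order unit space* $(A,L)$ is a norm-complete order unit space $A$ with a seminorm $L$ defined on a norm-dense subspace (and put equal to $\infty$ elsewhere) such that $\{a:L(a)=0\}=\mathbb R1_A$, the set $\{a\in A:L(a)\le 1\}$ is norm closed, and $$\mathsf{mk}_L(\varphi,\psi)=\sup\{|\varphi(a)-\psi(a)|:a\in A,\ L(a)\le 1\}$$ is a metric on $\mathscr S(A)$ inducing the weak* topology. Then $L$ is called a *Lip-norm* on $A$. Write $\mathsf{Haus}_{\mathsf{mk}_L}$ for the Hausdorff distance induced by $\mathsf{mk}_L$ between sets of states, with values in $[0,\infty]$.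 Let $(A,L_A)$ and $(B,L_B)$ be quantum metric order unit spaces. A Lip-norm $L$ on $A\oplus B$ is *admissible* if $L_A(a)=\inf_{b\in B}L(a,b)$ for all $a\in A$ and $L_B(b)=\inf_{a\in A}L(a,b)$ for all $b\in B$. *Rieffel's quantum Gromov-Hausdorff distance* is $$\mathsf{dist}_q((A,L_A),(B,L_B))=\inf\{\mathsf{Haus}_{\mathsf{mk}_L}(\mathscr S(A),\mathscr S(B)): L\text{ admissible for }L_A\text{ and }L_B\},$$ where $\mathscr S(A)$ and $\mathscr S(B)$ are viewed inside $\mathscr S(A\oplus B)$ by composition with the canonical surjections of $A\oplus B$ onto $A$ and $B$. A *quantum order unit isometry* $\pi:(D,L_D)\to(A,L_A)$ is a positive linear map with $\pi(1_D)=1_A$ and $L_A(a)=\inf\{L_D(d):\pi(d)=a\}$ for all $a\in A$, where $\inf\emptyset=\infty$. An *order unit tunnel* $\tau=(D,L_D,\pi_A,\pi_B)$ from $(A,L_A)$ to $(B,L_B)$ consists of a quantum metric order unit space $(D,L_D)$ and surjective quantum order unit isometries $\pi_A:(D,L_D)\to(A,L_A)$ and $\pi_B:(D,L_D)\to(B,L_B)$.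 Its *extent* is $$\chi(\tau)=\max_{C\in\{A,B\}}\mathsf{Haus}_{\mathsf{mk}_{L_D}}\bigl(\mathscr S(D),\{\varphi\circ\pi_C:\varphi\in\mathscr S(C)\}\bigr).$$ **Theorem.** If $(A,L_A)$ and $(B,L_B)$ are two quantum metric order unit spaces, then $$\mathsf{dist}_q((A,L_A),(B,L_B))=\inf\{\chi(\tau):\tau\text{ is an order unit tunnel from }(A,L_A)\text{ to }(B,L_B)\}.$$ -/

import Mathlib

open scoped ENNReal

universe u v

/-- A (real, Archimedean) order unit space: a partially ordered real vector space with a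
distinguished Archimedean order unit `ounit`, equipped with its order unit norm. -/
class OrderUnitSpace (A : Type u) extends NormedAddCommGroup A, NormedSpace ℝ A,
    PartialOrder A, IsOrderedAddMonoid A, IsOrderedModule ℝ A where
  /-- The order unit. -/
  ounit : A
  exists_bound : ∀ a : A, ∃ r : ℝ, 0 < r ∧ -(r • ounit) ≤ a ∧ a ≤ r • ounit
  archimedean : ∀ a : A, (∀ r : ℝ, 0 < r → a ≤ r • ounit) → a ≤ 0
  /-- The norm is the order unit norm. -/
  norm_eq : ∀ a : A, ‖a‖ = sInf {r : ℝ | 0 < r ∧ -(r • ounit) ≤ a ∧ a ≤ r • ounit}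

namespace OrderUnitSpace

/-- The set of all bounds of `a` is upwards closed. -/
theorem bound_mono {A : Type u} [OrderUnitSpace A] {a : A} {r s : ℝ} (hr : 0 < r)
    (h1 : -(r • (ounit : A)) ≤ a) (h2 : a ≤ r • (ounit : A)) (hrs : r ≤ s) :
    0 < s ∧ -(s • (ounit : A)) ≤ a ∧ a ≤ s • (ounit : A) := by
  have h0 : (0 : A) ≤ r • (ounit : A) := by
    have h := add_le_add (neg_le.mp h1) h2
    rw [neg_add_cancel, ← two_smul ℝ (r • (ounit : A))] at h
    have h' := smul_le_smul_of_nonneg_left h (by norm_num : (0 : ℝ) ≤ 1 / 2)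
    rw [smul_zero, smul_smul] at h'
    norm_num at h'
    exact h'
  have hu : (0 : A) ≤ (ounit : A) := by
    have h' := smul_le_smul_of_nonneg_left h0 (inv_nonneg.mpr hr.le)
    rwa [smul_zero, smul_smul, inv_mul_cancel₀ hr.ne', one_smul] at h'
  have hle : r • (ounit : A) ≤ s • (ounit : A) := smul_le_smul_of_nonneg_right hrs hu
  exact ⟨hr.trans_le hrs, (neg_le_neg hle).trans h1, h2.trans hle⟩

/-- The direct sum of two order unit spaces, with the componentwise order, the unit `(1, 1)` and
the maximum norm. -/
noncomputable instance instProd {A : Type u} {B : Type v} [OrderUnitSpace A] [OrderUnitSpace B] :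
    OrderUnitSpace (A × B) where
  toNormedAddCommGroup := inferInstance
  toNormedSpace := inferInstance
  toPartialOrder := inferInstance
  toIsOrderedAddMonoid := inferInstance
  toIsOrderedModule :=
    { smul_le_smul_of_nonneg_left := fun _ hr _ _ h =>
        ⟨smul_le_smul_of_nonneg_left h.1 hr, smul_le_smul_of_nonneg_left h.2 hr⟩
      smul_le_smul_of_nonneg_right := fun _ hx _ _ h =>
        ⟨smul_le_smul_of_nonneg_right h hx.1, smul_le_smul_of_nonneg_right h hx.2⟩ }
  ounit := (ounit, ounit)
  exists_bound := by
    rintro ⟨a, b⟩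
    obtain ⟨r, hr, h1, h2⟩ := exists_bound a
    obtain ⟨s, hs, h3, h4⟩ := exists_bound b
    obtain ⟨h5, h6, h7⟩ := bound_mono hr h1 h2 (le_max_left r s)
    obtain ⟨_, h8, h9⟩ := bound_mono hs h3 h4 (le_max_right r s)
    exact ⟨max r s, h5, ⟨h6, h8⟩, ⟨h7, h9⟩⟩
  archimedean := by
    rintro ⟨a, b⟩ h
    exact ⟨archimedean a fun r hr => (h r hr).1, archimedean b fun r hr => (h r hr).2⟩
  norm_eq := by
    rintro ⟨a, b⟩
    rw [Prod.norm_mk, norm_eq a, norm_eq b]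
    have ha : BddBelow {r : ℝ | 0 < r ∧ -(r • (ounit : A)) ≤ a ∧ a ≤ r • (ounit : A)} :=
      ⟨0, fun _ h => h.1.le⟩
    have hb : BddBelow {r : ℝ | 0 < r ∧ -(r • (ounit : B)) ≤ b ∧ b ≤ r • (ounit : B)} :=
      ⟨0, fun _ h => h.1.le⟩
    apply le_antisymm
    · refine le_csInf ?_ ?_
      · obtain ⟨r, hr, h1, h2⟩ := exists_bound a
        obtain ⟨s, hs, h3, h4⟩ := exists_bound b
        obtain ⟨h5, h6, h7⟩ := bound_mono hr h1 h2 (le_max_left r s)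
        obtain ⟨_, h8, h9⟩ := bound_mono hs h3 h4 (le_max_right r s)
        exact ⟨max r s, h5, ⟨h6, h8⟩, ⟨h7, h9⟩⟩
      · rintro r ⟨hr, h1, h2⟩
        exact max_le (csInf_le ha ⟨hr, h1.1, h2.1⟩) (csInf_le hb ⟨hr, h1.2, h2.2⟩)
    · refine le_of_forall_gt_imp_ge_of_dense fun t ht => ?_
      obtain ⟨r, ⟨hr, h1, h2⟩, hrt⟩ := exists_lt_of_csInf_lt (exists_bound a)
        ((le_max_left _ _).trans_lt ht)
      obtain ⟨s, ⟨hs, h3, h4⟩, hst⟩ := exists_lt_of_csInf_lt (exists_bound b)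
        ((le_max_right _ _).trans_lt ht)
      obtain ⟨h5, h6, h7⟩ := bound_mono hr h1 h2 hrt.le
      obtain ⟨_, h8, h9⟩ := bound_mono hs h3 h4 hst.le
      exact csInf_le ⟨0, fun _ h => h.1.le⟩ ⟨h5, ⟨h6, h8⟩, ⟨h7, h9⟩⟩

/-- A positive linear map that sends the order unit to the order unit. -/
structure UnitalPositiveMap (A : Type u) (B : Type v) [OrderUnitSpace A] [OrderUnitSpace B]
    extends A →ₗ[ℝ] B where
  map_nonneg : ∀ a : A, 0 ≤ a → 0 ≤ toFun a
  map_ounit : toFun ounit = ounit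

/-- The canonical surjection `(a, b) ↦ a`. -/
def projFst (A : Type u) (B : Type v) [OrderUnitSpace A] [OrderUnitSpace B] :
    UnitalPositiveMap (A × B) A where
  toLinearMap := LinearMap.fst ℝ A B
  map_nonneg := fun _ h => h.1
  map_ounit := rfl

/-- The canonical surjection `(a, b) ↦ b`. -/
def projSnd (A : Type u) (B : Type v) [OrderUnitSpace A] [OrderUnitSpace B] :
    UnitalPositiveMap (A × B) B where
  toLinearMap := LinearMap.snd ℝ A B
  map_nonneg := fun _ h => h.2
  map_ounit := rfl

/-- The state space: positive linear functionals with value `1` at the order unit. -/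
structure State (A : Type u) [OrderUnitSpace A] extends A →ₗ[ℝ] ℝ where
  map_nonneg : ∀ a : A, 0 ≤ a → 0 ≤ toFun a
  map_ounit : toFun ounit = 1

/-- The weak* topology on the state space: the topology of pointwise convergence. -/
instance State.instTopologicalSpace (A : Type u) [OrderUnitSpace A] :
    TopologicalSpace (State A) :=
  TopologicalSpace.induced (fun (φ : State A) (a : A) => φ.toLinearMap a) inferInstance

/-- The state `φ ∘ π`. -/
def State.comp {A : Type u} {B : Type v} [OrderUnitSpace A] [OrderUnitSpace B]
    (φ : State B) (π : UnitalPositiveMap A B) : State A where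
  toLinearMap := φ.toLinearMap.comp π.toLinearMap
  map_nonneg := fun a ha => φ.map_nonneg _ (π.map_nonneg a ha)
  map_ounit := (congrArg φ.toLinearMap π.map_ounit).trans φ.map_ounit

/-- The Monge-Kantorovich metric of `L`. A seminorm `L` defined on a subspace of `A` is represented
by its extension with the value `∞` outside of that subspace. -/
noncomputable def kantorovich {A : Type u} [OrderUnitSpace A] (L : A → ℝ≥0∞)
    (φ ψ : State A) : ℝ≥0∞ :=
  ⨆ (a : A) (_ : L a ≤ 1), ENNReal.ofReal |φ.toLinearMap a - ψ.toLinearMap a|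

/-- The Monge-Kantorovich metric as an extended pseudometric structure on the state space. -/
@[reducible]
noncomputable def kantorovichSpace {A : Type u} [OrderUnitSpace A] (L : A → ℝ≥0∞) :
    PseudoEMetricSpace (State A) where
  edist := kantorovich L
  edist_self := fun φ => by simp [kantorovich]
  edist_comm := fun φ ψ => by simp [kantorovich, abs_sub_comm]
  edist_triangle := fun φ ψ χ => by
    refine iSup₂_le fun a ha => ?_
    refine le_trans ?_ (add_le_add
      (le_iSup₂_of_le (f := fun (a : A) (_ : L a ≤ 1) =>
        ENNReal.ofReal |φ.toLinearMap a - ψ.toLinearMap a|) a ha le_rfl)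
      (le_iSup₂_of_le (f := fun (a : A) (_ : L a ≤ 1) =>
        ENNReal.ofReal |ψ.toLinearMap a - χ.toLinearMap a|) a ha le_rfl))
    rw [← ENNReal.ofReal_add (abs_nonneg _) (abs_nonneg _)]
    exact ENNReal.ofReal_le_ofReal (abs_sub_le _ _ _)

/-- The Hausdorff distance between sets of states induced by the Monge-Kantorovich metric. -/
noncomputable def hausKantorovich {A : Type u} [OrderUnitSpace A] (L : A → ℝ≥0∞)
    (S T : Set (State A)) : ℝ≥0∞ :=
  @Metric.hausdorffEDist (State A) (kantorovichSpace L) S T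

/-- `(A, L)` is a quantum metric order unit space, and `L` is a Lip-norm on `A`: `A` is complete and
`L` is a seminorm with dense domain `{a | L a < ∞}` such that

* `L a = 0` exactly for the scalar multiples of the order unit;
* the Monge-Kantorovich metric of `L` is a metric which induces the weak* topology;
* the unit ball of `L` is closed. -/
structure IsQuantumMetric (A : Type u) [OrderUnitSpace A] (L : A → ℝ≥0∞) : Prop where
  complete : CompleteSpace A
  smul : ∀ (r : ℝ) (a : A), L (r • a) = ENNReal.ofReal |r| * L a
  add_le : ∀ a b : A, L (a + b) ≤ L a + L b
  dense_dom : Dense {a : A | L a < ∞}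
  zero_set : {a : A | L a = 0} = Set.range fun r : ℝ => r • (ounit : A)
  kantorovich_ne_top : ∀ φ ψ : State A, kantorovich L φ ψ ≠ ∞
  eq_of_kantorovich_eq_zero : ∀ φ ψ : State A, kantorovich L φ ψ = 0 → φ = ψ
  weakStar : (kantorovichSpace L).toUniformSpace.toTopologicalSpace =
    State.instTopologicalSpace A
  isClosed_ball : IsClosed {a : A | L a ≤ 1}

/-- Admissible Lip-norms on the direct sum: both quotient seminorms are the given ones. -/
structure IsAdmissible {A : Type u} {B : Type v} [OrderUnitSpace A] [OrderUnitSpace B]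
    (LA : A → ℝ≥0∞) (LB : B → ℝ≥0∞) (L : A × B → ℝ≥0∞) : Prop where
  isQuantumMetric : IsQuantumMetric (A × B) L
  left : ∀ a : A, LA a = ⨅ b : B, L (a, b)
  right : ∀ b : B, LB b = ⨅ a : A, L (a, b)

/-- Rieffel's quantum Gromov-Hausdorff distance. The state space of a summand is identified with a
set of states of the direct sum through the canonical surjection. -/
noncomputable def distQ {A : Type u} {B : Type v} [OrderUnitSpace A] [OrderUnitSpace B]
    (LA : A → ℝ≥0∞) (LB : B → ℝ≥0∞) : ℝ≥0∞ :=
  ⨅ (L : A × B → ℝ≥0∞) (_ : IsAdmissible LA LB L),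
    hausKantorovich L (Set.range fun φ : State A => φ.comp (projFst A B))
      (Set.range fun ψ : State B => ψ.comp (projSnd A B))

/-- Quantum order unit isometries. The infimum of the empty set is `∞`. -/
def IsQuantumIsometry {A : Type u} {B : Type v} [OrderUnitSpace A] [OrderUnitSpace B]
    (LA : A → ℝ≥0∞) (LB : B → ℝ≥0∞) (π : UnitalPositiveMap A B) : Prop :=
  ∀ b : B, LB b = ⨅ (a : A) (_ : π.toLinearMap a = b), LA a

/-- Order unit tunnels from `(A, LA)` to `(B, LB)`. -/
structure Tunnel {A : Type u} {B : Type v} [OrderUnitSpace A] [OrderUnitSpace B]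
    (LA : A → ℝ≥0∞) (LB : B → ℝ≥0∞) where
  D : Type (max u v)
  [orderUnitSpace : OrderUnitSpace D]
  LD : D → ℝ≥0∞
  isQuantumMetric : IsQuantumMetric D LD
  projA : UnitalPositiveMap D A
  projB : UnitalPositiveMap D B
  surjective_projA : Function.Surjective projA.toLinearMap
  surjective_projB : Function.Surjective projB.toLinearMap
  isometry_projA : IsQuantumIsometry LD LA projA
  isometry_projB : IsQuantumIsometry LD LB projB

attribute [instance] Tunnel.orderUnitSpace

/-- The extent of an order unit tunnel. -/
noncomputable def Tunnel.extent {A : Type u} {B : Type v} [OrderUnitSpace A] [OrderUnitSpace B]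
    {LA : A → ℝ≥0∞} {LB : B → ℝ≥0∞} (τ : Tunnel LA LB) : ℝ≥0∞ :=
  max (hausKantorovich τ.LD Set.univ (Set.range fun φ : State A => φ.comp τ.projA))
    (hausKantorovich τ.LD Set.univ (Set.range fun ψ : State B => ψ.comp τ.projB))

end OrderUnitSpace

namespace OrderUnitSpace

open Filter Topology

/-! ### States of order unit spaces and of direct sums -/

section States

variable {A : Type u} {B : Type v} [OrderUnitSpace A] [OrderUnitSpace B]

/-! Both inequalities hold with no loss of constant. An admissible `L` makes `A × B` with its
projections a tunnel. A state of `A × B` is a convex combination of a state of `A` and a state of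
`B`, or one of these alone. Replacing its `B`-part by a nearby state of `A` moves it no further than
that part moves (`kantorovich_mix_le`), so the extent is at most the Hausdorff distance between the
two state spaces (`IsAdmissible.extent_tunnel_le`).

Conversely, let `r` exceed the extent of a tunnel, and call `φ` and `ψ` close if their pullbacks to
`D` are at distance at most `r`. Every state of either space has a close partner. Take on `A × B`
the maximum of `LA`, `LB` and all `|φ a - ψ b| / r` over close pairs (`glue`). Close pairs are then
within `r`, which bounds the Hausdorff distance. The quotients are right because `d ↦ (projA d,
projB d)` does not increase the seminorm: a nearly optimal lift of `a` to `D` supplies the `b`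
(`Tunnel.isAdmissible_glue`). The main remaining work is that the glued metric induces the weak*
topology (`tendsto_kantorovich_glue`); states are split into components, and components of vanishing
weight are handled by boundedness of the metric. -/

theorem ounit_nonneg : (0 : A) ≤ ounit := by
  obtain ⟨r, hr, h1, h2⟩ := exists_bound (0 : A)
  have h' := smul_le_smul_of_nonneg_left h2 (inv_nonneg.mpr hr.le)
  rwa [smul_zero, smul_smul, inv_mul_cancel₀ hr.ne', one_smul] at h'

theorem State.ext {φ ψ : State A} (h : ∀ a, φ.toLinearMap a = ψ.toLinearMap a) : φ = ψ := by
  cases φ; cases ψ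
  congr 1
  exact LinearMap.ext h

theorem State.apply_ounit (φ : State A) : φ.toLinearMap ounit = 1 := φ.map_ounit

theorem State.apply_nonneg (φ : State A) {a : A} (h : 0 ≤ a) : 0 ≤ φ.toLinearMap a :=
  φ.map_nonneg a h

/-- A positive functional is bounded by its value at the order unit. -/
theorem abs_apply_le_of_bound {f : A →ₗ[ℝ] ℝ} (hf : ∀ a, 0 ≤ a → 0 ≤ f a) {a : A} {r : ℝ}
    (h1 : -(r • (ounit : A)) ≤ a) (h2 : a ≤ r • (ounit : A)) : |f a| ≤ r * f ounit := by
  have h3 := hf _ (sub_nonneg.mpr h2)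
  have h4 := hf _ (sub_nonneg.mpr h1)
  simp only [map_sub, map_neg, map_smul, smul_eq_mul] at h3 h4
  exact abs_le.mpr ⟨by linarith, by linarith⟩

theorem State.abs_apply_le_norm (φ : State A) (a : A) : |φ.toLinearMap a| ≤ ‖a‖ := by
  rw [norm_eq]
  refine le_csInf (exists_bound a) ?_
  rintro r ⟨-, h1, h2⟩
  simpa [φ.apply_ounit] using abs_apply_le_of_bound (fun _ => φ.apply_nonneg) h1 h2

theorem apply_eq_zero_of_apply_ounit {f : A →ₗ[ℝ] ℝ} (hf : ∀ a, 0 ≤ a → 0 ≤ f a)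
    (h : f ounit = 0) (a : A) : f a = 0 := by
  obtain ⟨r, -, h1, h2⟩ := exists_bound a
  have := abs_apply_le_of_bound hf h1 h2
  rw [h, mul_zero] at this
  exact abs_nonpos_iff.mp this

/-- The normalization of a nonzero positive functional is a state. -/
theorem exists_state_of_apply_ounit_ne_zero {f : A →ₗ[ℝ] ℝ} (hf : ∀ a, 0 ≤ a → 0 ≤ f a)
    (h : f ounit ≠ 0) : ∃ φ : State A, ∀ a, f a = f ounit * φ.toLinearMap a := by
  refine ⟨⟨(f ounit)⁻¹ • f, fun a ha => ?_, ?_⟩, fun a => ?_⟩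
  · exact mul_nonneg (inv_nonneg.mpr (hf _ ounit_nonneg)) (hf a ha)
  · exact inv_mul_cancel₀ h
  · exact (mul_inv_cancel_left₀ h (f a)).symm

/-- If `f ounit = 0` then `f = 0` and any state serves; nonemptiness is needed only there. -/
theorem exists_state_apply_eq [Nonempty (State A)] {f : A →ₗ[ℝ] ℝ}
    (hf : ∀ a, 0 ≤ a → 0 ≤ f a) : ∃ φ : State A, ∀ a, f a = f ounit * φ.toLinearMap a := by
  by_cases h : f ounit = 0
  · refine ⟨Classical.arbitrary _, fun a => ?_⟩
    rw [apply_eq_zero_of_apply_ounit hf h a, h, zero_mul]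
  · exact exists_state_of_apply_ounit_ne_zero hf h

variable (A) in
/-- A nontrivial order unit space has a state. -/
theorem nonempty_state (h : (ounit : A) ≠ 0) : Nonempty (State A) := by
  let f : A →ₗ.[ℝ] ℝ := LinearPMap.mkSpanSingleton (ounit : A) (1 : ℝ) h
  have hu : ∀ r : ℝ, (r • ounit : A) ∈ f.domain := fun r =>
    Submodule.smul_mem _ _ (Submodule.mem_span_singleton_self _)
  have hval : ∀ (r : ℝ) (hr : (r • ounit : A) ∈ f.domain), f ⟨r • ounit, hr⟩ = r := fun r hr => by
    have := LinearPMap.mkSpanSingleton'_apply (ounit : A) (1 : ℝ)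
      (fun c hc => by
        rcases smul_eq_zero.mp hc with h' | h'
        · simp [h']
        · exact absurd h' h) r hr
    exact this.trans (mul_one r)
  -- Extends `r • ounit ↦ r`. This is positive on the span: `0 ≤ r • ounit` with `r < 0` would give
  -- `ounit ≤ 0`, hence `ounit = 0`.
  obtain ⟨g, hg, hgpos⟩ := riesz_extension (PointedCone.positive ℝ A) f
    (by
      rintro ⟨x, hx⟩ hxs
      obtain ⟨r, rfl⟩ := Submodule.mem_span_singleton.mp hx
      rw [hval]
      by_contra! hr
      have h1 : (0 : A) ≤ r • ounit := (PointedCone.mem_positive ℝ A).mp hxs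
      have h2 : (0 : A) ≤ (-r)⁻¹ • (r • ounit) :=
        smul_nonneg (inv_nonneg.mpr (by linarith)) h1
      rw [smul_smul, inv_neg, neg_mul, inv_mul_cancel₀ hr.ne, neg_one_smul] at h2
      exact h (le_antisymm (neg_nonneg.mp h2) ounit_nonneg))
    (by
      intro y
      obtain ⟨r, -, h1, -⟩ := exists_bound y
      refine ⟨⟨r • ounit, hu r⟩, ?_⟩
      exact (PointedCone.mem_positive ℝ A).mpr (neg_le_iff_add_nonneg'.mp h1))
  refine ⟨⟨g, fun a ha => hgpos a ((PointedCone.mem_positive ℝ A).mpr ha), ?_⟩⟩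
  have := hg ⟨(1 : ℝ) • ounit, hu 1⟩
  rw [hval] at this
  simpa using this

/-- Convex combinations of states. -/
def State.mix (s : ℝ) (h0 : 0 ≤ s) (h1 : s ≤ 1) (φ ψ : State A) : State A where
  toLinearMap := s • φ.toLinearMap + (1 - s) • ψ.toLinearMap
  map_nonneg := fun _ ha => add_nonneg (mul_nonneg h0 (φ.apply_nonneg ha))
    (mul_nonneg (sub_nonneg.mpr h1) (ψ.apply_nonneg ha))
  map_ounit := by
    change s * φ.toLinearMap ounit + (1 - s) * ψ.toLinearMap ounit = 1
    rw [φ.apply_ounit, ψ.apply_ounit]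
    ring

theorem State.mix_apply (s : ℝ) (h0 : 0 ≤ s) (h1 : s ≤ 1) (φ ψ : State A) (a : A) :
    (State.mix s h0 h1 φ ψ).toLinearMap a =
      s * φ.toLinearMap a + (1 - s) * ψ.toLinearMap a := rfl

theorem State.tendsto_iff {X : Type*} {l : Filter X} {f : X → State A} {φ : State A} :
    Tendsto f l (𝓝 φ) ↔
      ∀ a, Tendsto (fun x => (f x).toLinearMap a) l (𝓝 (φ.toLinearMap a)) := by
  have h : IsInducing (fun (φ : State A) (a : A) => φ.toLinearMap a) := ⟨rfl⟩
  rw [h.tendsto_nhds_iff, tendsto_pi_nhds]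
  rfl

theorem State.tendsto_apply (φ : State A) (a : A) :
    Tendsto (fun ψ : State A => ψ.toLinearMap a) (𝓝 φ) (𝓝 (φ.toLinearMap a)) :=
  State.tendsto_iff.mp tendsto_id a

/-- The weight which a state of the direct sum gives to the first summand. -/
noncomputable def State.weight (χ : State (A × B)) : ℝ := χ.toLinearMap (ounit, 0)

theorem State.weight_nonneg (χ : State (A × B)) : 0 ≤ χ.weight :=
  χ.apply_nonneg ⟨ounit_nonneg, le_rfl⟩

theorem State.apply_zero_ounit (χ : State (A × B)) :
    χ.toLinearMap (0, ounit) = 1 - χ.weight := by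
  have h : χ.toLinearMap ((ounit, 0) + (0, ounit)) = 1 := by
    rw [Prod.mk_add_mk, add_zero, zero_add]
    exact χ.apply_ounit
  rw [map_add] at h
  rw [State.weight]
  linarith

theorem State.weight_le_one (χ : State (A × B)) : χ.weight ≤ 1 := by
  have h : 0 ≤ χ.toLinearMap (0, ounit) := χ.apply_nonneg ⟨le_rfl, ounit_nonneg⟩
  rw [χ.apply_zero_ounit] at h
  linarith

theorem State.apply_prod (χ : State (A × B)) (x : A × B) :
    χ.toLinearMap x = χ.toLinearMap (x.1, 0) + χ.toLinearMap (0, x.2) := by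
  rw [← map_add, Prod.mk_add_mk, add_zero, zero_add]

theorem State.exists_fst [Nonempty (State A)] (χ : State (A × B)) :
    ∃ φ : State A, ∀ a, χ.toLinearMap (a, 0) = χ.weight * φ.toLinearMap a :=
  exists_state_apply_eq (f := χ.toLinearMap.comp (LinearMap.inl ℝ A B))
    fun _ ha => χ.apply_nonneg ⟨ha, le_rfl⟩

theorem State.exists_snd [Nonempty (State B)] (χ : State (A × B)) :
    ∃ ψ : State B, ∀ b, χ.toLinearMap (0, b) = (1 - χ.weight) * ψ.toLinearMap b := by
  obtain ⟨ψ, h⟩ := exists_state_apply_eq (f := χ.toLinearMap.comp (LinearMap.inr ℝ A B))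
    fun _ hb => χ.apply_nonneg ⟨le_rfl, hb⟩
  refine ⟨ψ, fun b => ?_⟩
  rw [← χ.apply_zero_ounit]
  exact h b

theorem State.nonempty_fst_of_weight_ne_zero (χ : State (A × B)) (h : χ.weight ≠ 0) :
    Nonempty (State A) :=
  (exists_state_of_apply_ounit_ne_zero (f := χ.toLinearMap.comp (LinearMap.inl ℝ A B))
    (fun _ ha => χ.apply_nonneg ⟨ha, le_rfl⟩) h).nonempty

theorem State.nonempty_snd_of_weight_ne_one (χ : State (A × B)) (h : χ.weight ≠ 1) :
    Nonempty (State B) :=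
  (exists_state_of_apply_ounit_ne_zero (f := χ.toLinearMap.comp (LinearMap.inr ℝ A B))
    (fun _ hb => χ.apply_nonneg ⟨le_rfl, hb⟩)
    (by
      change χ.toLinearMap (0, ounit) ≠ 0
      rw [χ.apply_zero_ounit]
      exact sub_ne_zero.mpr (Ne.symm h))).nonempty

/-- The states of a direct sum are the convex combinations of states of the summands. -/
theorem State.prod_cases (χ : State (A × B)) :
    (∃ φ : State A, χ = φ.comp (projFst A B)) ∨ (∃ ψ : State B, χ = ψ.comp (projSnd A B)) ∨
      ∃ (s : ℝ) (h0 : 0 ≤ s) (h1 : s ≤ 1) (φ : State A) (ψ : State B),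
        χ = State.mix s h0 h1 (φ.comp (projFst A B)) (ψ.comp (projSnd A B)) := by
  -- A summand of weight zero may be the zero space, which has no states, so the endpoints are
  -- separate cases.
  by_cases h0 : χ.weight = 0
  · have := χ.nonempty_snd_of_weight_ne_one (by rw [h0]; exact zero_ne_one)
    obtain ⟨ψ, hψ⟩ := χ.exists_snd
    refine Or.inr (Or.inl ⟨ψ, State.ext fun x => ?_⟩)
    have h := apply_eq_zero_of_apply_ounit (f := χ.toLinearMap.comp (LinearMap.inl ℝ A B))
      (fun _ ha => χ.apply_nonneg ⟨ha, le_rfl⟩) h0 x.1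
    change χ.toLinearMap (x.1, 0) = 0 at h
    rw [χ.apply_prod, hψ, h, h0, zero_add, sub_zero, one_mul]
    rfl
  have := χ.nonempty_fst_of_weight_ne_zero h0
  obtain ⟨φ, hφ⟩ := χ.exists_fst
  by_cases h1 : χ.weight = 1
  · refine Or.inl ⟨φ, State.ext fun x => ?_⟩
    have h := apply_eq_zero_of_apply_ounit (f := χ.toLinearMap.comp (LinearMap.inr ℝ A B))
      (fun _ hb => χ.apply_nonneg ⟨le_rfl, hb⟩)
      (by
        change χ.toLinearMap (0, ounit) = 0
        rw [χ.apply_zero_ounit, h1, sub_self]) x.2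
    change χ.toLinearMap (0, x.2) = 0 at h
    rw [χ.apply_prod, hφ, h, h1, add_zero, one_mul]
    rfl
  · have := χ.nonempty_snd_of_weight_ne_one h1
    obtain ⟨ψ, hψ⟩ := χ.exists_snd
    refine Or.inr (Or.inr ⟨χ.weight, χ.weight_nonneg, χ.weight_le_one, φ, ψ,
      State.ext fun x => ?_⟩)
    rw [χ.apply_prod, hφ, hψ]
    rfl

end States

/-! ### The Monge-Kantorovich metric and the weak* topology -/

section Kantorovich

variable {A : Type u} [OrderUnitSpace A] {L : A → ℝ≥0∞}

theorem kantorovich_comm (φ ψ : State A) : kantorovich L φ ψ = kantorovich L ψ φ :=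
  (kantorovichSpace L).edist_comm φ ψ

theorem kantorovich_self (φ : State A) : kantorovich L φ φ = 0 :=
  (kantorovichSpace L).edist_self φ

theorem ofReal_abs_sub_le_kantorovich (φ ψ : State A) {a : A} (ha : L a ≤ 1) :
    ENNReal.ofReal |φ.toLinearMap a - ψ.toLinearMap a| ≤ kantorovich L φ ψ :=
  le_iSup₂_of_le (f := fun (a : A) (_ : L a ≤ 1) =>
    ENNReal.ofReal |φ.toLinearMap a - ψ.toLinearMap a|) a ha le_rfl

theorem ofReal_abs_sub_le_mul_kantorovich
    (hL : ∀ (r : ℝ) (a : A), L (r • a) = ENNReal.ofReal |r| * L a) (φ ψ : State A) {a : A}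
    {c : ℝ} (hc : 0 < c) (ha : L a ≤ ENNReal.ofReal c) :
    ENNReal.ofReal |φ.toLinearMap a - ψ.toLinearMap a| ≤
      ENNReal.ofReal c * kantorovich L φ ψ := by
  have h1 : L (c⁻¹ • a) ≤ 1 := by
    rw [hL, abs_of_pos (inv_pos.mpr hc), ENNReal.ofReal_inv_of_pos hc]
    calc (ENNReal.ofReal c)⁻¹ * L a ≤ (ENNReal.ofReal c)⁻¹ * ENNReal.ofReal c := by gcongr
      _ ≤ 1 := ENNReal.inv_mul_le_one _
  refine le_trans (le_of_eq ?_) (mul_le_mul_right (ofReal_abs_sub_le_kantorovich φ ψ h1) _)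
  rw [← ENNReal.ofReal_mul hc.le, map_smul, map_smul, smul_eq_mul, smul_eq_mul, ← mul_sub,
    abs_mul, abs_of_pos (inv_pos.mpr hc), mul_inv_cancel_left₀ hc.ne']

theorem hausKantorovich_le {S T : Set (State A)} {r : ℝ≥0∞}
    (h1 : ∀ φ ∈ S, ∃ ψ ∈ T, kantorovich L φ ψ ≤ r)
    (h2 : ∀ ψ ∈ T, ∃ φ ∈ S, kantorovich L ψ φ ≤ r) : hausKantorovich L S T ≤ r :=
  @Metric.hausdorffEDist_le_of_mem_edist (State A) (kantorovichSpace L) S T r h1 h2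

theorem exists_kantorovich_lt_left {S T : Set (State A)} {r : ℝ≥0∞} {φ : State A}
    (h : φ ∈ S) (hr : hausKantorovich L S T < r) : ∃ ψ ∈ T, kantorovich L φ ψ < r :=
  @Metric.exists_edist_lt_of_hausdorffEDist_lt (State A) (kantorovichSpace L) φ S T r h hr

theorem hausKantorovich_comm (S T : Set (State A)) :
    hausKantorovich L S T = hausKantorovich L T S :=
  @Metric.hausdorffEDist_comm (State A) (kantorovichSpace L) S T

theorem kantorovich_mix_le (s : ℝ) (h0 : 0 ≤ s) (h1 : s ≤ 1) (σ ρ ρ' : State A) :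
    kantorovich L (State.mix s h0 h1 σ ρ) (State.mix s h0 h1 σ ρ') ≤ kantorovich L ρ ρ' := by
  refine iSup₂_le fun a ha => (ENNReal.ofReal_le_ofReal ?_).trans
    (ofReal_abs_sub_le_kantorovich ρ ρ' ha)
  rw [State.mix_apply, State.mix_apply, add_sub_add_left_eq_sub, ← mul_sub, abs_mul,
    abs_of_nonneg (sub_nonneg.mpr h1)]
  exact mul_le_of_le_one_left (abs_nonneg _) (by linarith)

/-- The mixture differs from `ψ` by exactly `s` times the difference of `φ` and `ψ`. -/
theorem kantorovich_le_mul_kantorovich_mix {s : ℝ} (h0 : 0 < s) (h1 : s ≤ 1) (φ ψ : State A) :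
    kantorovich L φ ψ ≤
      ENNReal.ofReal s⁻¹ * kantorovich L (State.mix s h0.le h1 φ ψ) ψ := by
  refine iSup₂_le fun a ha => le_trans (le_of_eq ?_)
    (mul_le_mul_right (ofReal_abs_sub_le_kantorovich _ _ ha) _)
  rw [← ENNReal.ofReal_mul (inv_nonneg.mpr h0.le), State.mix_apply]
  congr 1
  have : s * φ.toLinearMap a + (1 - s) * ψ.toLinearMap a - ψ.toLinearMap a =
      s * (φ.toLinearMap a - ψ.toLinearMap a) := by ring
  rw [this, abs_mul, abs_of_pos h0, inv_mul_cancel_left₀ h0.ne']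

theorem IsQuantumMetric.tendsto_kantorovich (hL : IsQuantumMetric A L) {X : Type*}
    {l : Filter X} {f : X → State A} {φ : State A} (h : Tendsto f l (𝓝 φ)) :
    Tendsto (fun x => kantorovich L (f x) φ) l (𝓝 0) := by
  rw [← hL.weakStar] at h
  let _ := kantorovichSpace L
  exact tendsto_iff_edist_tendsto_0.mp h

/-- The state space is bounded for the Monge-Kantorovich metric of a Lip-norm. -/
theorem IsQuantumMetric.exists_kantorovich_le (hL : IsQuantumMetric A L) (φ : State A) :
    ∃ M : ℝ≥0∞, M ≠ ∞ ∧ ∀ ψ, kantorovich L ψ φ ≤ M := by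
  by_contra! hcon
  have hpos : ∀ n : ℕ, (0 : ℝ) < 1 / ((n : ℝ) + 1) := fun n => Nat.one_div_pos_of_nat
  have hle : ∀ n : ℕ, 1 / ((n : ℝ) + 1) ≤ 1 := fun n => by
    rw [div_le_one (by positivity)]
    linarith [n.cast_nonneg (α := ℝ)]
  choose ψ hψ using fun n : ℕ => hcon (ENNReal.ofReal ((n : ℝ) + 1)) ENNReal.ofReal_ne_top
  -- `ψ n` is more than `n + 1` away from `φ`. Mixed into `φ` with weight `1 / (n + 1)`, it tends
  -- weak* to `φ` yet stays at distance more than one, a contradiction.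
  have hlim : Tendsto (fun n : ℕ => State.mix _ (hpos n).le (hle n) (ψ n) φ) atTop (𝓝 φ) := by
    rw [State.tendsto_iff]
    intro a
    rw [tendsto_iff_dist_tendsto_zero]
    have h2 : Tendsto (fun n : ℕ => 1 / ((n : ℝ) + 1) * (‖a‖ + ‖a‖)) atTop (𝓝 0) := by
      simpa using tendsto_one_div_add_atTop_nhds_zero_nat.mul_const (‖a‖ + ‖a‖)
    refine squeeze_zero (fun _ => dist_nonneg) (fun n => ?_) h2
    have : ∀ s : ℝ, s * (ψ n).toLinearMap a + (1 - s) * φ.toLinearMap a - φ.toLinearMap a =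
      s * ((ψ n).toLinearMap a - φ.toLinearMap a) := fun s => by ring
    rw [Real.dist_eq, State.mix_apply, this, abs_mul, abs_of_pos (hpos n)]
    refine mul_le_mul_of_nonneg_left ?_ (hpos n).le
    exact (abs_sub _ _).trans
      (add_le_add ((ψ n).abs_apply_le_norm a) (φ.abs_apply_le_norm a))
  obtain ⟨n, hn⟩ := ((hL.tendsto_kantorovich hlim).eventually_lt_const zero_lt_one).exists
  refine (hψ n).not_ge ((kantorovich_le_mul_kantorovich_mix (hpos n) (hle n) (ψ n) φ).trans ?_)
  calc _ ≤ ENNReal.ofReal (1 / ((n : ℝ) + 1))⁻¹ * 1 := by gcongr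
    _ = _ := by rw [mul_one, one_div, inv_inv]

/-- Convergence in the Monge-Kantorovich metric implies weak* convergence. -/
theorem tendsto_of_tendsto_kantorovich
    (hL : ∀ (r : ℝ) (a : A), L (r • a) = ENNReal.ofReal |r| * L a)
    (hd : Dense {a : A | L a < ∞}) {X : Type*} {l : Filter X} {f : X → State A} {φ : State A}
    (h : Tendsto (fun x => kantorovich L (f x) φ) l (𝓝 0)) : Tendsto f l (𝓝 φ) := by
  rw [State.tendsto_iff]
  intro a
  rw [Metric.tendsto_nhds]
  intro ε hε
  -- Passing from `a` to `b` costs less than `ε / 4` at each of the two states, and their values at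
  -- `b` will differ by less than `ε / 4`.
  obtain ⟨b, hb, hab⟩ := hd.exists_dist_lt a (ε := ε / 4) (by positivity)
  -- The `+ 1` keeps the scale positive when `L b = 0`.
  have hc : 0 < (L b).toReal + 1 := by positivity
  have hLb : L b ≤ ENNReal.ofReal ((L b).toReal + 1) :=
    (ENNReal.le_ofReal_iff_toReal_le (ne_of_lt hb) hc.le).mpr (by linarith)
  have h' := ENNReal.Tendsto.const_mul (a := ENNReal.ofReal ((L b).toReal + 1)) h
    (Or.inr ENNReal.ofReal_ne_top)
  rw [mul_zero] at h'
  filter_upwards [h'.eventually_lt_const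
    (ENNReal.ofReal_pos.mpr (show 0 < ε / 4 by positivity))] with x hx
  have h1 := (ofReal_abs_sub_le_mul_kantorovich hL (f x) φ hc hLb).trans_lt hx
  rw [ENNReal.ofReal_lt_ofReal_iff (by positivity)] at h1
  have h2 := (f x).abs_apply_le_norm (a - b)
  have h3 := φ.abs_apply_le_norm (a - b)
  rw [map_sub] at h2 h3
  rw [dist_eq_norm] at hab
  rw [Real.dist_eq]
  rw [abs_le] at h2 h3
  rw [abs_lt] at h1 ⊢
  constructor <;> linarith [h1.1, h1.2, h2.1, h2.2, h3.1, h3.2]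

/-- Metric convergence already implies weak* convergence, so only the converse is left as a
hypothesis. -/
theorem topology_eq_of_tendsto
    (hL : ∀ (r : ℝ) (a : A), L (r • a) = ENNReal.ofReal |r| * L a)
    (hd : Dense {a : A | L a < ∞})
    (h : ∀ φ : State A, Tendsto (fun ψ => kantorovich L ψ φ) (𝓝 φ) (𝓝 0)) :
    (kantorovichSpace L).toUniformSpace.toTopologicalSpace =
      State.instTopologicalSpace A := by
  refine TopologicalSpace.ext_nhds fun φ => le_antisymm ?_ ?_
  · refine tendsto_of_tendsto_kantorovich (f := id) hL hd ?_
    let _ := kantorovichSpace L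
    exact tendsto_iff_edist_tendsto_0.mp tendsto_id
  · have h' := h φ
    let _ := kantorovichSpace L
    exact tendsto_iff_edist_tendsto_0.mpr h'

theorem eq_of_kantorovich_eq_zero_of_dense
    (hL : ∀ (r : ℝ) (a : A), L (r • a) = ENNReal.ofReal |r| * L a)
    (hd : Dense {a : A | L a < ∞}) {φ ψ : State A} (h : kantorovich L φ ψ = 0) : φ = ψ := by
  have h1 : Tendsto (fun _ : ℕ => φ) atTop (𝓝 ψ) :=
    tendsto_of_tendsto_kantorovich hL hd (by simp [h])
  exact State.ext fun a => tendsto_nhds_unique tendsto_const_nhds (State.tendsto_iff.mp h1 a)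

/-- If every state is a convex combination of a state in `S` and a state in `T`, and `S` is closed
under convex combinations, then `S` is as close to the whole state space as it is to `T`. -/
theorem hausKantorovich_univ_le {S T : Set (State A)} {r : ℝ≥0∞}
    (hmix : ∀ (s : ℝ) (h0 : 0 ≤ s) (h1 : s ≤ 1), ∀ φ ∈ S, ∀ ψ ∈ S, State.mix s h0 h1 φ ψ ∈ S)
    (hST : ∀ χ : State A, χ ∈ S ∨ χ ∈ T ∨
      ∃ (s : ℝ) (h0 : 0 ≤ s) (h1 : s ≤ 1), ∃ φ ∈ S, ∃ ψ ∈ T, χ = State.mix s h0 h1 φ ψ)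
    (hr : hausKantorovich L T S < r) : hausKantorovich L Set.univ S ≤ r := by
  refine hausKantorovich_le (fun χ _ => ?_)
    fun ψ _ => ⟨ψ, Set.mem_univ _, by simp [kantorovich_self]⟩
  rcases hST χ with h | h | ⟨s, h0, h1, φ, hφ, ψ, hψ, rfl⟩
  · exact ⟨χ, h, by simp [kantorovich_self]⟩
  · obtain ⟨ψ, h1, h2⟩ := exists_kantorovich_lt_left h hr
    exact ⟨ψ, h1, h2.le⟩
  · obtain ⟨ρ, hρ, h2⟩ := exists_kantorovich_lt_left hψ hr
    exact ⟨_, hmix s h0 h1 φ hφ ρ hρ, (kantorovich_mix_le s h0 h1 φ ψ ρ).trans h2.le⟩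

end Kantorovich

/-! ### From admissible Lip-norms to tunnels -/

section Admissible

variable {A : Type u} {B : Type v} [OrderUnitSpace A] [OrderUnitSpace B]
  {LA : A → ℝ≥0∞} {LB : B → ℝ≥0∞} {L : A × B → ℝ≥0∞}

/-- The tunnel given by an admissible Lip-norm. -/
noncomputable def IsAdmissible.tunnel (h : IsAdmissible LA LB L) : Tunnel LA LB where
  D := A × B
  LD := L
  isQuantumMetric := h.isQuantumMetric
  projA := projFst A B
  projB := projSnd A B
  surjective_projA := fun a => ⟨(a, 0), rfl⟩
  surjective_projB := fun b => ⟨(0, b), rfl⟩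
  isometry_projA := fun a => by
    rw [h.left a]
    refine le_antisymm (le_iInf₂ fun x hx => ?_) (le_iInf fun b => iInf₂_le_of_le (a, b) rfl le_rfl)
    rw [← hx]
    exact iInf_le (fun b => L (x.1, b)) x.2
  isometry_projB := fun b => by
    rw [h.right b]
    refine le_antisymm (le_iInf₂ fun x hx => ?_) (le_iInf fun a => iInf₂_le_of_le (a, b) rfl le_rfl)
    rw [← hx]
    exact iInf_le (fun a => L (a, x.2)) x.1

theorem IsAdmissible.extent_tunnel_le (h : IsAdmissible LA LB L) :
    h.tunnel.extent ≤ hausKantorovich L (Set.range fun φ : State A => φ.comp (projFst A B))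
      (Set.range fun ψ : State B => ψ.comp (projSnd A B)) := by
  refine le_of_forall_gt_imp_ge_of_dense fun r hr => ?_
  have hleft : hausKantorovich L Set.univ
      (Set.range fun φ : State A => φ.comp (projFst A B)) ≤ r := by
    rw [hausKantorovich_comm] at hr
    refine hausKantorovich_univ_le ?_ (fun χ => ?_) hr
    · rintro s h0 h1 _ ⟨φ, rfl⟩ _ ⟨ψ, rfl⟩
      exact ⟨State.mix s h0 h1 φ ψ, rfl⟩
    · rcases χ.prod_cases with ⟨φ, rfl⟩ | ⟨ψ, rfl⟩ | ⟨s, h0, h1, φ, ψ, rfl⟩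
      · exact Or.inl ⟨φ, rfl⟩
      · exact Or.inr (Or.inl ⟨ψ, rfl⟩)
      · exact Or.inr (Or.inr ⟨s, h0, h1, _, ⟨φ, rfl⟩, _, ⟨ψ, rfl⟩, rfl⟩)
  have hright : hausKantorovich L Set.univ
      (Set.range fun ψ : State B => ψ.comp (projSnd A B)) ≤ r := by
    refine hausKantorovich_univ_le ?_ (fun χ => ?_) hr
    · rintro s h0 h1 _ ⟨φ, rfl⟩ _ ⟨ψ, rfl⟩
      exact ⟨State.mix s h0 h1 φ ψ, rfl⟩
    · rcases χ.prod_cases with ⟨φ, rfl⟩ | ⟨ψ, rfl⟩ | ⟨s, h0, h1, φ, ψ, rfl⟩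
      · exact Or.inr (Or.inl ⟨φ, rfl⟩)
      · exact Or.inl ⟨ψ, rfl⟩
      -- With the roles of the summands exchanged, the weights are exchanged too.
      · refine Or.inr (Or.inr ⟨1 - s, sub_nonneg.mpr h1, by linarith, _, ⟨ψ, rfl⟩, _, ⟨φ, rfl⟩,
          State.ext fun x => ?_⟩)
        rw [State.mix_apply, State.mix_apply]
        ring
  exact max_le hleft hright

end Admissible

/-! ### The glued Lip-norm on the direct sum -/

section Gluing

variable {A : Type u} {B : Type v} [OrderUnitSpace A] [OrderUnitSpace B]

/-- The seminorm on `A × B` which glues `LA` and `LB` along a relation `P` between states: related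
states are at distance at most `r`. -/
noncomputable def glue (LA : A → ℝ≥0∞) (LB : B → ℝ≥0∞) (P : State A → State B → Prop) (r : ℝ)
    (x : A × B) : ℝ≥0∞ :=
  max (max (LA x.1) (LB x.2)) (⨆ (φ : State A) (ψ : State B) (_ : P φ ψ),
    ENNReal.ofReal (|φ.toLinearMap x.1 - ψ.toLinearMap x.2| / r))

variable {LA : A → ℝ≥0∞} {LB : B → ℝ≥0∞} {P : State A → State B → Prop} {r : ℝ}

theorem glue_le_iff {x : A × B} {c : ℝ≥0∞} : glue LA LB P r x ≤ c ↔
    LA x.1 ≤ c ∧ LB x.2 ≤ c ∧ ∀ φ ψ, P φ ψ →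
      ENNReal.ofReal (|φ.toLinearMap x.1 - ψ.toLinearMap x.2| / r) ≤ c := by
  simp only [glue, max_le_iff, iSup_le_iff, and_assoc]

theorem left_le_glue (x : A × B) : LA x.1 ≤ glue LA LB P r x := (glue_le_iff.mp le_rfl).1

theorem right_le_glue (x : A × B) : LB x.2 ≤ glue LA LB P r x := (glue_le_iff.mp le_rfl).2.1

theorem ofReal_le_glue (x : A × B) {φ : State A} {ψ : State B} (h : P φ ψ) :
    ENNReal.ofReal (|φ.toLinearMap x.1 - ψ.toLinearMap x.2| / r) ≤ glue LA LB P r x :=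
  (glue_le_iff.mp le_rfl).2.2 φ ψ h

theorem abs_sub_le_of_glue_le_one (hr : 0 < r) {x : A × B} (hx : glue LA LB P r x ≤ 1)
    {φ : State A} {ψ : State B} (h : P φ ψ) :
    |φ.toLinearMap x.1 - ψ.toLinearMap x.2| ≤ r := by
  have := (ofReal_le_glue x h).trans hx
  rwa [ENNReal.ofReal_le_one, div_le_one hr] at this

theorem glue_smul (hA : IsQuantumMetric A LA) (hB : IsQuantumMetric B LB) (s : ℝ) (x : A × B) :
    glue LA LB P r (s • x) = ENNReal.ofReal |s| * glue LA LB P r x := by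
  have hmax : ∀ c x y : ℝ≥0∞, c * max x y = max (c * x) (c * y) := fun c x y =>
    (show Monotone fun z => c * z from fun _ _ h => by dsimp only; gcongr).map_max
  simp only [glue, hmax, ENNReal.mul_iSup, Prod.smul_fst, Prod.smul_snd, hA.smul, hB.smul,
    map_smul, smul_eq_mul, ← mul_sub, abs_mul, mul_div_assoc, ENNReal.ofReal_mul (abs_nonneg s)]

theorem glue_add_le (hr : 0 < r) (hA : IsQuantumMetric A LA) (hB : IsQuantumMetric B LB)
    (x y : A × B) : glue LA LB P r (x + y) ≤ glue LA LB P r x + glue LA LB P r y := by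
  refine glue_le_iff.mpr ⟨?_, ?_, fun φ ψ h => ?_⟩
  · exact (hA.add_le _ _).trans (add_le_add (left_le_glue x) (left_le_glue y))
  · exact (hB.add_le _ _).trans (add_le_add (right_le_glue x) (right_le_glue y))
  · refine le_trans ?_ (add_le_add (ofReal_le_glue x h) (ofReal_le_glue y h))
    rw [← ENNReal.ofReal_add (by positivity) (by positivity), ← add_div]
    refine ENNReal.ofReal_le_ofReal (div_le_div_of_nonneg_right ?_ hr.le)
    rw [Prod.fst_add, Prod.snd_add, map_add, map_add, add_sub_add_comm]
    exact abs_add_le _ _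

/-- States have norm at most one, so the supremum is at most `(‖a‖ + ‖b‖) / r` and the domain
contains the product of the two domains. -/
theorem dense_glue_lt_top (hr : 0 < r) (hA : IsQuantumMetric A LA) (hB : IsQuantumMetric B LB) :
    Dense {x : A × B | glue LA LB P r x < ∞} := by
  refine (hA.dense_dom.prod hB.dense_dom).mono ?_
  rintro ⟨a, b⟩ ⟨ha, hb⟩
  refine max_lt (max_lt ha hb) (lt_of_le_of_lt (b := ENNReal.ofReal ((‖a‖ + ‖b‖) / r)) ?_
    ENNReal.ofReal_lt_top)
  refine iSup_le fun φ => iSup₂_le fun ψ _ => ENNReal.ofReal_le_ofReal ?_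
  refine div_le_div_of_nonneg_right ?_ hr.le
  exact (abs_sub _ _).trans (add_le_add (φ.abs_apply_le_norm a) (ψ.abs_apply_le_norm b))

theorem State.continuous (φ : State A) : Continuous φ.toLinearMap :=
  AddMonoidHomClass.continuous_of_bound φ.toLinearMap 1 fun a => by
    simpa using φ.abs_apply_le_norm a

theorem isClosed_glue_le_one (hr : 0 < r) (hA : IsQuantumMetric A LA)
    (hB : IsQuantumMetric B LB) : IsClosed {x : A × B | glue LA LB P r x ≤ 1} := by
  have : {x : A × B | glue LA LB P r x ≤ 1} = {a | LA a ≤ 1} ×ˢ {b | LB b ≤ 1} ∩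
      ⋂ (φ : State A) (ψ : State B) (_ : P φ ψ),
        {x : A × B | |φ.toLinearMap x.1 - ψ.toLinearMap x.2| ≤ r} := by
    ext x
    simp only [glue_le_iff, ENNReal.ofReal_le_one, div_le_one hr, Set.mem_ofPred_eq,
      Set.mem_inter_iff, Set.mem_prod, Set.mem_iInter, and_assoc]
  rw [this]
  refine (hA.isClosed_ball.prod hB.isClosed_ball).inter
    (isClosed_iInter fun φ => isClosed_iInter fun ψ => isClosed_iInter fun _ => ?_)
  exact isClosed_le (((φ.continuous.comp continuous_fst).sub
    (ψ.continuous.comp continuous_snd)).abs) continuous_const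

/-- `LA` and `LB` leave the elements `(s • ounit, t • ounit)`, and a single related pair forces `s =
t`. If both units vanish, the scalars do not matter. -/
theorem glue_zero_set (hr : 0 < r) (hA : IsQuantumMetric A LA) (hB : IsQuantumMetric B LB)
    (hP : (∃ φ ψ, P φ ψ) ∨ ((ounit : A) = 0 ∧ (ounit : B) = 0)) :
    {x : A × B | glue LA LB P r x = 0} = Set.range fun s : ℝ => s • (ounit : A × B) := by
  ext ⟨a, b⟩
  rw [Set.mem_ofPred_eq, ← nonpos_iff_eq_zero, glue_le_iff]
  simp only [nonpos_iff_eq_zero]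
  constructor
  · rintro ⟨ha, hb, h⟩
    have ha' : a ∈ {a | LA a = 0} := ha
    have hb' : b ∈ {b | LB b = 0} := hb
    rw [hA.zero_set] at ha'
    rw [hB.zero_set] at hb'
    obtain ⟨s, rfl⟩ := ha'
    obtain ⟨t, rfl⟩ := hb'
    rcases hP with ⟨φ, ψ, hP⟩ | ⟨h1, h2⟩
    · have h' := h φ ψ hP
      simp only [map_smul, φ.apply_ounit, ψ.apply_ounit, smul_eq_mul, mul_one,
        ENNReal.ofReal_eq_zero] at h'
      rw [div_le_iff₀ hr, zero_mul, abs_nonpos_iff, sub_eq_zero] at h'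
      subst h'
      exact ⟨s, rfl⟩
    · refine ⟨s, Prod.ext rfl ?_⟩
      change s • (ounit : B) = t • ounit
      rw [h2, smul_zero, smul_zero]
  · rintro ⟨s, hs⟩
    have h1 : s • (ounit : A) = a := congrArg Prod.fst hs
    have h2 : s • (ounit : B) = b := congrArg Prod.snd hs
    subst h1 h2
    refine ⟨?_, ?_, fun φ ψ _ => ?_⟩
    · exact hA.zero_set.ge ⟨s, rfl⟩
    · exact hB.zero_set.ge ⟨s, rfl⟩
    · simp [φ.apply_ounit, ψ.apply_ounit]

/-- The Monge-Kantorovich metric of the glued seminorm, estimated in terms of decompositions of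
states into convex combinations. -/
theorem kantorovich_glue_le (hr : 0 < r) {φ₁ : State A} {ψ₁ : State B} (hP : P φ₁ ψ₁)
    {χ χ' : State (A × B)} {φ φ' : State A} {ψ ψ' : State B}
    (hφ : ∀ a, χ.toLinearMap (a, 0) = χ.weight * φ.toLinearMap a)
    (hψ : ∀ b, χ.toLinearMap (0, b) = (1 - χ.weight) * ψ.toLinearMap b)
    (hφ' : ∀ a, χ'.toLinearMap (a, 0) = χ'.weight * φ'.toLinearMap a)
    (hψ' : ∀ b, χ'.toLinearMap (0, b) = (1 - χ'.weight) * ψ'.toLinearMap b) :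
    kantorovich (glue LA LB P r) χ χ' ≤
      ENNReal.ofReal χ.weight * kantorovich LA φ φ' +
      ENNReal.ofReal (1 - χ.weight) * kantorovich LB ψ ψ' +
      ENNReal.ofReal |χ.weight - χ'.weight| *
        (kantorovich LA φ' φ₁ + ENNReal.ofReal r + kantorovich LB ψ' ψ₁) := by
  refine iSup₂_le fun x hx => ?_
  have hxA := (left_le_glue x).trans hx
  have hxB := (right_le_glue x).trans hx
  have h1 := ofReal_abs_sub_le_kantorovich φ φ' hxA
  have h2 := ofReal_abs_sub_le_kantorovich ψ ψ' hxB
  have h3 := ofReal_abs_sub_le_kantorovich φ' φ₁ hxA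
  have h4 := ofReal_abs_sub_le_kantorovich ψ' ψ₁ hxB
  have h5 := abs_sub_le_of_glue_le_one hr hx hP
  have hw0 := χ.weight_nonneg
  have hw1 := sub_nonneg.mpr χ.weight_le_one
  calc ENNReal.ofReal |χ.toLinearMap x - χ'.toLinearMap x|
      ≤ ENNReal.ofReal (χ.weight * |φ.toLinearMap x.1 - φ'.toLinearMap x.1| +
          (1 - χ.weight) * |ψ.toLinearMap x.2 - ψ'.toLinearMap x.2| +
          |χ.weight - χ'.weight| * (|φ'.toLinearMap x.1 - φ₁.toLinearMap x.1| + r +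
            |ψ'.toLinearMap x.2 - ψ₁.toLinearMap x.2|)) := by
        apply ENNReal.ofReal_le_ofReal
        rw [χ.apply_prod, χ'.apply_prod, hφ, hψ, hφ', hψ']
        have h6 : |φ'.toLinearMap x.1 - ψ'.toLinearMap x.2| ≤
            |φ'.toLinearMap x.1 - φ₁.toLinearMap x.1| + r +
              |ψ'.toLinearMap x.2 - ψ₁.toLinearMap x.2| := by
          have := abs_sub_le (φ'.toLinearMap x.1) (φ₁.toLinearMap x.1) (ψ'.toLinearMap x.2)
          have := abs_sub_le (φ₁.toLinearMap x.1) (ψ₁.toLinearMap x.2) (ψ'.toLinearMap x.2)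
          rw [abs_sub_comm (ψ'.toLinearMap x.2)]
          linarith
        -- The first two terms move the components. The third shifts weight between the summands, at
        -- the price of comparing `φ'` with `ψ'` through the related pair `φ₁`, `ψ₁`.
        have h7 : ∀ t t' p p' q q' : ℝ, t * p + (1 - t) * q - (t' * p' + (1 - t') * q') =
          t * (p - p') + (1 - t) * (q - q') + (t - t') * (p' - q') := by intros; ring
        rw [h7]
        refine (abs_add_three _ _ _).trans ?_
        rw [abs_mul, abs_mul, abs_mul, abs_of_nonneg hw0, abs_of_nonneg hw1]
        gcongr
    _ ≤ _ := by
        rw [ENNReal.ofReal_add (by positivity) (by positivity),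
          ENNReal.ofReal_add (by positivity) (by positivity), ENNReal.ofReal_mul hw0,
          ENNReal.ofReal_mul hw1, ENNReal.ofReal_mul (abs_nonneg _),
          ENNReal.ofReal_add (by positivity) (by positivity),
          ENNReal.ofReal_add (by positivity) (by positivity)]
        gcongr

/-- Weighted components of weak* convergent families converge in the Monge-Kantorovich metric,
even if the limit weight vanishes. -/
theorem IsQuantumMetric.tendsto_weight_mul_kantorovich (hA : IsQuantumMetric A LA) {X : Type*}
    {l : Filter X} {w : X → ℝ} {w₀ : ℝ} {φ : X → State A} {φ₀ : State A}
    (hw : Tendsto w l (𝓝 w₀))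
    (h : ∀ a, Tendsto (fun x => w x * (φ x).toLinearMap a) l (𝓝 (w₀ * φ₀.toLinearMap a))) :
    Tendsto (fun x => ENNReal.ofReal (w x) * kantorovich LA (φ x) φ₀) l (𝓝 0) := by
  have hw' := ENNReal.tendsto_ofReal hw
  -- If the limit weight is zero, the components need not converge, but their distances to `φ₀` are
  -- bounded. Otherwise the weight can be divided out.
  by_cases h0 : w₀ = 0
  · obtain ⟨M, hM, hle⟩ := hA.exists_kantorovich_le φ₀
    have h1 := ENNReal.Tendsto.mul_const hw' (Or.inr hM)
    rw [h0, ENNReal.ofReal_zero, zero_mul] at h1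
    exact tendsto_of_tendsto_of_tendsto_of_le_of_le tendsto_const_nhds h1
      (fun _ => zero_le) fun x => mul_le_mul_right (hle _) _
  · have hφ : Tendsto φ l (𝓝 φ₀) := by
      rw [State.tendsto_iff]
      intro a
      have h1 := (h a).div hw h0
      rw [mul_div_cancel_left₀ _ h0] at h1
      refine h1.congr' ?_
      filter_upwards [hw.eventually_ne h0] with x hx
      exact mul_div_cancel_left₀ _ hx
    have h1 := ENNReal.Tendsto.mul hw' (Or.inr ENNReal.zero_ne_top) (hA.tendsto_kantorovich hφ)
      (Or.inr ENNReal.ofReal_ne_top)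
    rwa [mul_zero] at h1

theorem tendsto_kantorovich_glue (hr : 0 < r) (hA : IsQuantumMetric A LA)
    (hB : IsQuantumMetric B LB) {φ₁ : State A} {ψ₁ : State B} (hP : P φ₁ ψ₁)
    (χ₀ : State (A × B)) :
    Tendsto (fun χ => kantorovich (glue LA LB P r) χ χ₀) (𝓝 χ₀) (𝓝 0) := by
  have : Nonempty (State A) := ⟨φ₁⟩
  have : Nonempty (State B) := ⟨ψ₁⟩
  -- The choice need not be continuous: only the weighted components, which are values of `χ`, have
  -- to converge.
  choose φ hφ using fun χ : State (A × B) => χ.exists_fst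
  choose ψ hψ using fun χ : State (A × B) => χ.exists_snd
  have hw : Tendsto State.weight (𝓝 χ₀) (𝓝 χ₀.weight) := χ₀.tendsto_apply _
  have h1 := hA.tendsto_weight_mul_kantorovich (φ := φ) (φ₀ := φ χ₀) hw fun a => by
    simp only [← hφ]
    exact χ₀.tendsto_apply _
  have h2 := hB.tendsto_weight_mul_kantorovich (φ := ψ) (φ₀ := ψ χ₀) (hw.const_sub 1)
    fun b => by
      simp only [← hψ]
      exact χ₀.tendsto_apply _
  have h3 : Tendsto (fun χ : State (A × B) => ENNReal.ofReal |χ.weight - χ₀.weight| *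
      (kantorovich LA (φ χ₀) φ₁ + ENNReal.ofReal r + kantorovich LB (ψ χ₀) ψ₁))
      (𝓝 χ₀) (𝓝 0) := by
    have h4 := ENNReal.Tendsto.mul_const (ENNReal.tendsto_ofReal (hw.sub_const χ₀.weight).abs)
      (Or.inr (ENNReal.add_ne_top.mpr ⟨ENNReal.add_ne_top.mpr
        ⟨hA.kantorovich_ne_top (φ χ₀) φ₁, ENNReal.ofReal_ne_top (r := r)⟩,
        hB.kantorovich_ne_top (ψ χ₀) ψ₁⟩))
    simpa only [sub_self, abs_zero, ENNReal.ofReal_zero, zero_mul] using h4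
  have h5 := (h1.add h2).add h3
  rw [add_zero, add_zero] at h5
  exact tendsto_of_tendsto_of_tendsto_of_le_of_le tendsto_const_nhds h5 (fun _ => zero_le)
    fun χ => kantorovich_glue_le hr hP (hφ χ) (hψ χ) (hφ χ₀) (hψ χ₀)

theorem kantorovich_glue_ne_top (hr : 0 < r) (hA : IsQuantumMetric A LA)
    (hB : IsQuantumMetric B LB) {φ₁ : State A} {ψ₁ : State B} (hP : P φ₁ ψ₁)
    (χ χ' : State (A × B)) : kantorovich (glue LA LB P r) χ χ' ≠ ∞ := by
  have : Nonempty (State A) := ⟨φ₁⟩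
  have : Nonempty (State B) := ⟨ψ₁⟩
  obtain ⟨φ, hφ⟩ := χ.exists_fst
  obtain ⟨ψ, hψ⟩ := χ.exists_snd
  obtain ⟨φ', hφ'⟩ := χ'.exists_fst
  obtain ⟨ψ', hψ'⟩ := χ'.exists_snd
  refine ne_top_of_le_ne_top ?_ (kantorovich_glue_le hr hP hφ hψ hφ' hψ')
  simp [ENNReal.mul_eq_top, hA.kantorovich_ne_top, hB.kantorovich_ne_top]

theorem isQuantumMetric_glue (hr : 0 < r) (hA : IsQuantumMetric A LA)
    (hB : IsQuantumMetric B LB)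
    (hP : (∃ φ ψ, P φ ψ) ∨ ((ounit : A) = 0 ∧ (ounit : B) = 0)) :
    IsQuantumMetric (A × B) (glue LA LB P r) := by
  -- If both units vanish there are no states, so a given state already yields a related pair.
  have hP' : ∀ _ : State (A × B), ∃ φ ψ, P φ ψ := fun χ => hP.resolve_right fun ⟨h1, h2⟩ => by
    have h3 := χ.apply_ounit
    rw [show (ounit : A × B) = 0 from Prod.ext h1 h2, map_zero] at h3
    exact zero_ne_one h3
  have hd := dense_glue_lt_top (P := P) hr hA hB
  refine ⟨?_, glue_smul hA hB, glue_add_le hr hA hB, hd, glue_zero_set hr hA hB hP,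
    fun χ χ' => ?_, fun χ χ' h => eq_of_kantorovich_eq_zero_of_dense (glue_smul hA hB) hd h,
    topology_eq_of_tendsto (glue_smul hA hB) hd fun χ => ?_, isClosed_glue_le_one hr hA hB⟩
  · have := hA.complete
    have := hB.complete
    exact inferInstanceAs (CompleteSpace (A × B))
  · obtain ⟨φ, ψ, h⟩ := hP' χ
    exact kantorovich_glue_ne_top hr hA hB h χ χ'
  · obtain ⟨φ, ψ, h⟩ := hP' χ
    exact tendsto_kantorovich_glue hr hA hB h χ

end Gluing

/-! ### From tunnels to admissible Lip-norms -/

section Tunnels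

variable {A : Type u} {B : Type v} [OrderUnitSpace A] [OrderUnitSpace B]
  {LA : A → ℝ≥0∞} {LB : B → ℝ≥0∞}

theorem IsQuantumIsometry.le {LA : A → ℝ≥0∞} {LB : B → ℝ≥0∞} {π : UnitalPositiveMap A B}
    (h : IsQuantumIsometry LA LB π) (a : A) : LB (π.toLinearMap a) ≤ LA a :=
  (h _).le.trans (iInf₂_le_of_le a rfl le_rfl)

theorem IsQuantumIsometry.exists_lt {LA : A → ℝ≥0∞} {LB : B → ℝ≥0∞} {π : UnitalPositiveMap A B}
    (h : IsQuantumIsometry LA LB π) {b : B} {c : ℝ≥0∞} (hc : LB b < c) :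
    ∃ a, π.toLinearMap a = b ∧ LA a < c := by
  rw [h b] at hc
  simpa only [iInf_lt_iff, exists_prop] using hc

namespace Tunnel

variable (τ : Tunnel LA LB) {r : ℝ}

/-- Two states are related if they are at distance at most `r` in the tunnel. -/
def Close (r : ℝ) (φ : State A) (ψ : State B) : Prop :=
  kantorovich τ.LD (φ.comp τ.projA) (ψ.comp τ.projB) ≤ ENNReal.ofReal r

/-- The pullbacks of a close pair differ at `d` by at most `c * r`; this is what the denominator `r`
in `glue` is for. -/
theorem glue_proj_le (hr : 0 < r) {d : τ.D} {c : ℝ} (hc : 0 < c)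
    (hd : τ.LD d ≤ ENNReal.ofReal c) :
    glue LA LB (τ.Close r) r (τ.projA.toLinearMap d, τ.projB.toLinearMap d) ≤
      ENNReal.ofReal c := by
  refine glue_le_iff.mpr ⟨(τ.isometry_projA.le d).trans hd, (τ.isometry_projB.le d).trans hd,
    fun φ ψ h => ENNReal.ofReal_le_ofReal ?_⟩
  have h1 := (ofReal_abs_sub_le_mul_kantorovich τ.isQuantumMetric.smul (φ.comp τ.projA)
    (ψ.comp τ.projB) hc hd).trans (mul_le_mul_right h _)
  rw [← ENNReal.ofReal_mul hc.le, ENNReal.ofReal_le_ofReal_iff (by positivity)] at h1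
  exact (div_le_iff₀ hr).mpr h1

/-- The `B`-half of the extent puts every state of `D`, in particular one coming from `A`, within
`r` of a state coming from `B`. -/
theorem exists_close_left (hr : τ.extent < ENNReal.ofReal r) (φ : State A) :
    ∃ ψ, τ.Close r φ ψ := by
  obtain ⟨_, ⟨ψ, rfl⟩, h⟩ := exists_kantorovich_lt_left (Set.mem_univ (φ.comp τ.projA))
    ((le_max_right _ _).trans_lt hr)
  exact ⟨ψ, h.le⟩

theorem exists_close_right (hr : τ.extent < ENNReal.ofReal r) (ψ : State B) :
    ∃ φ, τ.Close r φ ψ := by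
  obtain ⟨_, ⟨φ, rfl⟩, h⟩ := exists_kantorovich_lt_left (Set.mem_univ (ψ.comp τ.projB))
    ((le_max_left _ _).trans_lt hr)
  exact ⟨φ, by rw [Close, kantorovich_comm]; exact h.le⟩

theorem exists_close_or (hr : τ.extent < ENNReal.ofReal r) :
    (∃ φ ψ, τ.Close r φ ψ) ∨ ((ounit : A) = 0 ∧ (ounit : B) = 0) := by
  by_cases hA : (ounit : A) = 0
  · by_cases hB : (ounit : B) = 0
    · exact Or.inr ⟨hA, hB⟩
    · obtain ⟨ψ⟩ := nonempty_state B hB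
      obtain ⟨φ, h⟩ := τ.exists_close_right hr ψ
      exact Or.inl ⟨φ, ψ, h⟩
  · obtain ⟨φ⟩ := nonempty_state A hA
    exact Or.inl ⟨φ, τ.exists_close_left hr φ⟩

theorem isAdmissible_glue (hr0 : 0 < r) (hr : τ.extent < ENNReal.ofReal r)
    (hA : IsQuantumMetric A LA) (hB : IsQuantumMetric B LB) :
    IsAdmissible LA LB (glue LA LB (τ.Close r) r) := by
  have key : ∀ {x c : ℝ≥0∞}, x < c → c ≠ ∞ → 0 < c.toReal ∧ ENNReal.ofReal c.toReal = c :=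
    fun h hc => ⟨ENNReal.toReal_pos (ne_bot_of_gt h) hc, ENNReal.ofReal_toReal hc⟩
  refine ⟨isQuantumMetric_glue hr0 hA hB (τ.exists_close_or hr), fun a => ?_, fun b => ?_⟩
  · refine le_antisymm (le_iInf fun b => left_le_glue (a, b)) ?_
    refine le_of_forall_gt_imp_ge_of_dense fun c hc => ?_
    rcases eq_or_ne c ∞ with rfl | hct
    · exact le_top
    obtain ⟨h1, h2⟩ := key hc hct
    -- `d` is a nearly optimal lift of `a`; its image in `B` is the witness for the infimum.
    obtain ⟨d, rfl, hd⟩ := τ.isometry_projA.exists_lt hc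
    rw [← h2] at hd ⊢
    exact (iInf_le _ _).trans (τ.glue_proj_le hr0 h1 hd.le)
  · refine le_antisymm (le_iInf fun a => right_le_glue (a, b)) ?_
    refine le_of_forall_gt_imp_ge_of_dense fun c hc => ?_
    rcases eq_or_ne c ∞ with rfl | hct
    · exact le_top
    obtain ⟨h1, h2⟩ := key hc hct
    obtain ⟨d, rfl, hd⟩ := τ.isometry_projB.exists_lt hc
    rw [← h2] at hd ⊢
    exact (iInf_le _ _).trans (τ.glue_proj_le hr0 h1 hd.le)

theorem kantorovich_glue_le_of_close (hr0 : 0 < r) {φ : State A} {ψ : State B}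
    (h : τ.Close r φ ψ) :
    kantorovich (glue LA LB (τ.Close r) r) (φ.comp (projFst A B)) (ψ.comp (projSnd A B)) ≤
      ENNReal.ofReal r :=
  iSup₂_le fun _ hx => ENNReal.ofReal_le_ofReal (abs_sub_le_of_glue_le_one hr0 hx h)

theorem distQ_le_extent (hA : IsQuantumMetric A LA) (hB : IsQuantumMetric B LB) :
    distQ LA LB ≤ τ.extent := by
  refine le_of_forall_gt_imp_ge_of_dense fun c hc => ?_
  rcases eq_or_ne c ∞ with rfl | hct
  · exact le_top
  -- Any finite `c` above the extent serves as the gluing parameter `r`.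
  have hr0 : 0 < c.toReal := ENNReal.toReal_pos (ne_bot_of_gt hc) hct
  rw [← ENNReal.ofReal_toReal hct] at hc ⊢
  refine (iInf₂_le _ (τ.isAdmissible_glue hr0 hc hA hB)).trans (hausKantorovich_le ?_ ?_)
  · rintro _ ⟨φ, rfl⟩
    obtain ⟨ψ, h⟩ := τ.exists_close_left hc φ
    exact ⟨_, ⟨ψ, rfl⟩, τ.kantorovich_glue_le_of_close hr0 h⟩
  · rintro _ ⟨ψ, rfl⟩
    obtain ⟨φ, h⟩ := τ.exists_close_right hc ψ
    refine ⟨_, ⟨φ, rfl⟩, ?_⟩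
    rw [kantorovich_comm]
    exact τ.kantorovich_glue_le_of_close hr0 h

end Tunnel

end Tunnels

end OrderUnitSpace

theorem mainTheorem5 {A : Type u} {B : Type v} [OrderUnitSpace A] [OrderUnitSpace B]
    (LA : A → ℝ≥0∞) (LB : B → ℝ≥0∞)
    (hA : OrderUnitSpace.IsQuantumMetric A LA) (hB : OrderUnitSpace.IsQuantumMetric B LB) :
    OrderUnitSpace.distQ LA LB =
      ⨅ τ : OrderUnitSpace.Tunnel LA LB, τ.extent := by
  refine le_antisymm (le_iInf fun τ => τ.distQ_le_extent hA hB) ?_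
  exact le_iInf₂ fun L hL => (iInf_le _ hL.tunnel).trans hL.extent_tunnel_le
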